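/- Notation. For $m\in\mathbb Z$ and $N\in\mathbb N=\{0,1,2,\dots\}$ put $S_{m,N}=\{k\in\mathbb Z:|k-m|\le N\}$, so $|S_{m,N}|=2N+1$. A discrete weight is a function $\omega:\mathbb Z\to(0,\infty)$. For $1<p,q<\infty$ and $p'=p/(p-1)$, write $\omega\in\mathcal A(p,q)$ if $$\sup_{m\in\mathbb Z,\,N\in\mathbb N}\Big(\frac1{|S_{m,N}|}\sum_{k\in S_{m,N}}\omega(k)^q\Big)^{1/q}\Big(\frac1{|S_{m,N}|}\sum_{k\in S_{m,N}}\omega(k)^{-p'}\Big)^{1/p'}<\infty .$$ For a weight $v$, $l^p_v$ is the space of real sequences $x=\{x(k)\}_{k\in\mathbb Z}$ with $\|x\|_{l^p_v}=\big(\sum_{k\in\mathbb Z}|x(k)|^p v(k)\big)^{1/p}<\infty$. For $0<\alpha<1$ the discrete Riesz potential is $I_\alpha x(k)=\sum_{i\in\mathbb Z\setminus\{k\}}\frac{x(i)}{|k-i|^{1-\alpha}}$, $k\in\mathbb Z$. That $I_\alpha$ is bounded from $l^p_v$ to $l^q_w$ means: for every $x\in l^p_v$ the series $I_\alpha x(k)$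 converges absolutely for every $k$, and there is a constant $C>0$, independent of $x$, with $\|I_\alpha x\|_{l^q_w}\le C\|x\|_{l^p_v}$ for all $x\in l^p_v$. Theorem 1.4. Let $0<\alpha<1$, $1<p<\frac1\alpha$, $\frac1q=\frac1p-\alpha$, and let $\omega:\mathbb Z\to(0,\infty)$ be a discrete weight. (i) If $\omega\in\mathcal A(p,q)$, then $I_\alpha$ is bounded from $l^p_{\omega^p}$ to $l^q_{\omega^q}$. (ii) Conversely, if $\omega$ is monotonic (non-decreasing or non-increasing) on its support $\{k\in\mathbb Z:\omega(k)\ne0\}$ (which is $\mathbb Z$, as $\omega>0$) and $I_\alpha$ is bounded from $l^p_{\omega^p}$ to $l^q_{\omega^q}$, then $\omega\in\mathcal A(p,q)$. -/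

import Mathlib

noncomputable section

namespace DiscreteRiesz

/-- The symmetric interval `S_{m,N} = {k ∈ ℤ : |k - m| ≤ N}`. -/
def symInterval (m : ℤ) (N : ℕ) : Finset ℤ := Finset.Icc (m - N) (m + N)

theorem mem_symInterval {m k : ℤ} {N : ℕ} : k ∈ symInterval m N ↔ |k - m| ≤ N := by
  rw [symInterval, Finset.mem_Icc, abs_le]
  omega

/-- The average `|S_{m,N}|⁻¹ ∑_{k ∈ S_{m,N}} f(k)`. -/
def average (f : ℤ → ℝ) (m : ℤ) (N : ℕ) : ℝ :=
  (∑ k ∈ symInterval m N, f k) / ((symInterval m N).card : ℝ)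

/-- The class `𝒜(p,q)(ℤ)` for `1 < p, q < ∞`: the supremum over all `m ∈ ℤ`, `N ∈ ℕ` of
`(avg_{S_{m,N}} ω^q)^{1/q} (avg_{S_{m,N}} ω^{-p'})^{1/p'}` is finite, where `p' = p/(p-1)`.
It is meant for weights `ω : ℤ → (0,∞)`. -/
def ClassA (p q : ℝ) (ω : ℤ → ℝ) : Prop :=
  BddAbove (Set.range fun mN : ℤ × ℕ =>
    (average (fun k => ω k ^ q) mN.1 mN.2) ^ (1 / q) *
      (average (fun k => ω k ^ (-(p / (p - 1)))) mN.1 mN.2) ^ (1 / (p / (p - 1))))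

/-- Membership of a real sequence in `l^p_v(ℤ)`: `∑_k |x(k)|^p v(k) < ∞`. -/
def MemWeightedLp (p : ℝ) (v x : ℤ → ℝ) : Prop :=
  Summable fun k => |x k| ^ p * v k

/-- The norm of `l^p_v(ℤ)`: `(∑_k |x(k)|^p v(k))^{1/p}`, for `x` in that space. -/
def weightedNorm (p : ℝ) (v x : ℤ → ℝ) : ℝ :=
  (∑' k, |x k| ^ p * v k) ^ (1 / p)

/-- The term of index `i` in the series defining `I_α x(k)`, for `i ≠ k`. -/
def rieszTerm (α : ℝ) (x : ℤ → ℝ) (k : ℤ) (i : {i : ℤ // i ≠ k}) : ℝ :=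
  x i / |(k : ℝ) - ((i : ℤ) : ℝ)| ^ (1 - α)

/-- The discrete Riesz potential `I_α x(k) = ∑_{i ≠ k} x(i) / |k - i|^{1-α}`. -/
def riesz (α : ℝ) (x : ℤ → ℝ) (k : ℤ) : ℝ :=
  ∑' i : {i : ℤ // i ≠ k}, rieszTerm α x k i

/-- `I_α` is bounded from `l^p_v(ℤ)` to `l^q_w(ℤ)`: for every `x ∈ l^p_v` all the series `I_α x(k)`
converge, `I_α x ∈ l^q_w`, and `‖I_α x‖ ≤ C ‖x‖` with `C` independent of `x`. -/
def RieszBounded (α p q : ℝ) (v w : ℤ → ℝ) : Prop :=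
  ∃ C : ℝ, 0 < C ∧ ∀ x : ℤ → ℝ, MemWeightedLp p v x →
    (∀ k : ℤ, Summable (rieszTerm α x k)) ∧
    MemWeightedLp q w (riesz α x) ∧
    weightedNorm q w (riesz α x) ≤ C * weightedNorm p v x

end DiscreteRiesz

end

/-! Put β = 1 - α, p' = p/(p-1), σ = ω^(-p'), w = ω^q. Since 1/q + 1/p' = β, membership in 𝒜(p,q)
reads w(S)^(1/q) σ(S)^(1/p') ≤ K |S|^β for all intervals S. As w^(1/q) σ^(1/p') = 1 pointwise,
Hölder then makes both σ and w A_∞ weights (`exists_aInfty`): their masses are doubling and grow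
geometrically with the scale.

Sufficiency. By duality it is enough to bound the form ∑ |k-i|^(-β) f(i)σ(i) g(k)w(k) for normalized
f ∈ L^p(σ), g ∈ L^(q')(w). The kernel is dominated by a sum over dyadic scales and all centres of
indicators of intervals (`kernel_le_sum`), and the class condition trades |S|^(-β) for σ(S)^(-1/p')
w(S)^(-1/q). What remains is a sum of products of two normalized averages. Because p < q, there is r
with p < r < q; Young's inequality with r, r' separates the factors, and each is summed by an
embedding L^p(v) → ℓ^r with r > p (`AInfty.embedding`). There the r-th power of an average over S is
at most a constant times the sum over S of v f^p damped by a factor that is small unless v(S) is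
comparable to f^(-p). For a fixed point the masses grow geometrically, so the damping factors have a
bounded sum over all scales.

Necessity. Testing on σ·1_S gives the class condition, the missing diagonal term being restored by
the inclusion ℓ^p ⊂ ℓ^q (`RieszBounded.classA`). -/

namespace DiscreteRiesz

open Finset Filter Topology

/-! ### The bump function and means damped by it -/

/-- The smooth substitute `u / (1 + u)²` for `min u u⁻¹`. -/
noncomputable def bump (u : ℝ) : ℝ := u / (1 + u) ^ 2

theorem bump_nonneg {u : ℝ} (hu : 0 ≤ u) : 0 ≤ bump u := by
  unfold bump; positivity

/-- Geometric growth makes the sum telescope: `bump u` is at most R/(R-1) times the drop of 1/(1+u)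
between u and Ru. -/
theorem sum_bump_le {R : ℝ} (hR : 1 < R) {u : ℕ → ℝ} (hu : ∀ n, 0 ≤ u n)
    (h : ∀ n, R * u n ≤ u (n + 1)) (L : ℕ) :
    ∑ n ∈ range L, bump (u n) ≤ R / (R - 1) := by
  have hR' : 0 < R - 1 := by linarith
  have key : ∀ n, bump (u n) ≤
      R / (R - 1) * ((1 + u n)⁻¹ - (1 + u (n + 1))⁻¹) := by
    intro n
    have h0 := hu n
    have h1 : (1 + u (n + 1))⁻¹ ≤ (1 + R * u n)⁻¹ := by
      have := h n
      gcongr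
    have h2 : bump (u n) ≤ R / (R - 1) * ((1 + u n)⁻¹ - (1 + R * u n)⁻¹) := by
      have e : R / (R - 1) * ((1 + u n)⁻¹ - (1 + R * u n)⁻¹) =
          (R * u n) / ((1 + u n) * (1 + R * u n)) := by
        have : (1 + R * u n) ≠ 0 := by positivity
        field_simp
        ring
      rw [e, bump, div_le_div_iff₀ (by positivity) (by positivity)]
      have : 0 ≤ u n * (1 + u n) * (R - 1) := by positivity
      nlinarith
    refine h2.trans ?_
    gcongr
  calc ∑ n ∈ range L, bump (u n)
      ≤ ∑ n ∈ range L, R / (R - 1) * ((1 + u n)⁻¹ - (1 + u (n + 1))⁻¹) :=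
        sum_le_sum fun n _ => key n
    _ = R / (R - 1) * ((1 + u 0)⁻¹ - (1 + u L)⁻¹) := by
        rw [← mul_sum, sum_range_sub' (fun n => (1 + u n)⁻¹)]
    _ ≤ R / (R - 1) * 1 := by
        have h0 := hu 0
        have hL := hu L
        have : (1 + u 0)⁻¹ ≤ 1 := inv_le_one_of_one_le₀ (by linarith)
        have : 0 ≤ (1 + u L)⁻¹ := by positivity
        gcongr
        linarith
    _ = R / (R - 1) := mul_one _

theorem bump_le_mul_bump {u u' B : ℝ} (hu : 0 ≤ u) (hu' : 0 ≤ u') (hB : 1 ≤ B)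
    (h₁ : u' ≤ B * u) (h₂ : u ≤ B * u') : bump u' ≤ B ^ 3 * bump u := by
  have h : 1 + u ≤ B * (1 + u') := by nlinarith
  have h3 : (1 + u) ^ 2 ≤ (B * (1 + u')) ^ 2 := by gcongr
  rw [bump, bump, ← mul_div_assoc, div_le_div_iff₀ (by positivity) (by positivity)]
  calc u' * (1 + u) ^ 2 ≤ (B * u) * (B * (1 + u')) ^ 2 := by gcongr
    _ = B ^ 3 * u * (1 + u') ^ 2 := by ring

/-- Values t < b are absorbed by b^r. For b ≤ t ≤ 1 the left side is at most t^(p+δ), and for t ≥ 1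
at most t^(p-δ); up to the factor 4, `bump (t ^ δ)` supplies the t^δ or t^(-δ) in either range. -/
theorem mul_rpow_le_bump {p r δ t b : ℝ} (hδ : 0 < δ) (hδp : δ ≤ p - 1)
    (hr : p + δ ≤ r) (ht : 0 ≤ t) (hb : 0 < b) (hb1 : b ≤ 1) :
    t * b ^ (r - 1) ≤ 4 * (t ^ p * bump (t ^ δ)) + b ^ r := by
  have hbr : b ^ r = b * b ^ (r - 1) := by
    rw [← Real.rpow_one_add' hb.le (by linarith)]; congr 1; ring
  have hbump := bump_nonneg (Real.rpow_nonneg ht δ)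
  have htp := Real.rpow_nonneg ht p
  rcases lt_or_ge t b with h | h
  · have : t * b ^ (r - 1) ≤ b ^ r := by rw [hbr]; gcongr
    have : 0 ≤ t ^ p * bump (t ^ δ) := by positivity
    linarith
  have ht0 : 0 < t := hb.trans_le h
  have htδ : 0 < t ^ δ := Real.rpow_pos_of_pos ht0 δ
  suffices hs : t * b ^ (r - 1) ≤ 4 * (t ^ p * bump (t ^ δ)) by
    have : 0 ≤ b ^ r := by positivity
    linarith
  rcases le_or_gt 1 t with h1 | h1
  · have hu : 1 ≤ t ^ δ := Real.one_le_rpow h1 hδ.le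
    have e1 : (t ^ δ)⁻¹ ≤ 4 * bump (t ^ δ) := by
      rw [bump, ← mul_div_assoc, inv_eq_one_div, div_le_div_iff₀ htδ (by positivity)]
      nlinarith
    calc t * b ^ (r - 1) ≤ t * 1 := by
          gcongr; exact Real.rpow_le_one hb.le hb1 (by linarith)
      _ ≤ t ^ (p - δ) := by
          rw [mul_one]
          conv_lhs => rw [← Real.rpow_one t]
          exact Real.rpow_le_rpow_of_exponent_le h1 (by linarith)
      _ = t ^ p * (t ^ δ)⁻¹ := by rw [Real.rpow_sub ht0, div_eq_mul_inv]
      _ ≤ t ^ p * (4 * bump (t ^ δ)) := by gcongr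
      _ = _ := by ring
  · have hu : t ^ δ ≤ 1 := Real.rpow_le_one ht h1.le hδ.le
    have e1 : t ^ δ ≤ 4 * bump (t ^ δ) := by
      rw [bump, ← mul_div_assoc, le_div_iff₀ (by positivity)]
      have : (1 + t ^ δ) ^ 2 ≤ 4 := by nlinarith
      nlinarith
    calc t * b ^ (r - 1) ≤ t * b ^ (p + δ - 1) := by
          have := Real.rpow_le_rpow_of_exponent_ge hb hb1 (show p + δ - 1 ≤ r - 1 by linarith)
          gcongr
      _ ≤ t * t ^ (p + δ - 1) := by
          gcongr; linarith
      _ = t ^ p * t ^ δ := by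
          rw [← Real.rpow_one_add' ht (by linarith), ← Real.rpow_add ht0]; congr 1; ring
      _ ≤ t ^ p * (4 * bump (t ^ δ)) := by gcongr
      _ = _ := by ring

/-- A weighted mean controlled by the bump functional at the scale of the total mass. -/
theorem rpow_mean_le_sum_bump {ι : Type*} {Q : Finset ι} {v f : ι → ℝ} {p r δ : ℝ}
    (hv : ∀ k, 0 < v k) (hf : ∀ k, 0 ≤ f k) (hQ : Q.Nonempty) (hδ : 0 < δ)
    (hδp : δ ≤ p - 1) (hr : p + δ ≤ r) (h1 : ∑ k ∈ Q, f k ^ p * v k ≤ 1) :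
    ((∑ k ∈ Q, v k) ^ (1 / p - 1) * ∑ k ∈ Q, f k * v k) ^ r ≤
      2 ^ r * 4 * ∑ k ∈ Q, v k * f k ^ p * bump ((f k ^ p * ∑ k ∈ Q, v k) ^ (δ / p)) := by
  set V := ∑ k ∈ Q, v k with hVdef
  have hV : 0 < V := sum_pos (fun k _ => hv k) hQ
  have hp : 0 < p := by linarith
  -- With this scaling `a` below is the mean of t for the probability weights v/V, and the mean of
  -- t^p is at most 1.
  set t : ι → ℝ := fun k => f k * V ^ (1 / p) with ht
  have ht0 : ∀ k, 0 ≤ t k := fun k => by have := hf k; simp only [ht]; positivity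
  have htp : ∀ k, t k ^ p = f k ^ p * V := fun k => by
    simp only [ht]
    rw [Real.mul_rpow (hf k) (by positivity), ← Real.rpow_mul hV.le, one_div,
      inv_mul_cancel₀ hp.ne', Real.rpow_one]
  have htδ : ∀ k, (f k ^ p * V) ^ (δ / p) = t k ^ δ := fun k => by
    rw [← htp, ← Real.rpow_mul (ht0 k), mul_div_cancel₀ _ hp.ne']
  set a := V ^ (1 / p - 1) * ∑ k ∈ Q, f k * v k with ha
  have hVa : V * a = ∑ k ∈ Q, v k * t k := by
    rw [ha, ← mul_assoc, ← Real.rpow_one_add' hV.le (by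
      have : 0 < 1 / p := by positivity
      linarith), mul_sum]
    refine sum_congr rfl fun k _ => ?_
    simp only [ht]
    rw [show 1 + (1 / p - 1) = 1 / p by ring]
    ring
  have ha0 : 0 ≤ a := by
    have : 0 ≤ ∑ k ∈ Q, f k * v k := sum_nonneg fun k _ => mul_nonneg (hf k) (hv k).le
    positivity
  have hle : ∀ k, t k ≤ 1 + t k ^ p := fun k => by
    rcases le_total (t k) 1 with h | h
    · have := Real.rpow_nonneg (ht0 k) p
      linarith
    · have := Real.rpow_le_rpow_of_exponent_le h (show (1 : ℝ) ≤ p by linarith)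
      rw [Real.rpow_one] at this
      linarith
  have ha2 : a ≤ 2 := by
    have : V * a ≤ V * 2 := by
      calc V * a = ∑ k ∈ Q, v k * t k := hVa
        _ ≤ ∑ k ∈ Q, v k * (1 + t k ^ p) :=
          sum_le_sum fun k _ => mul_le_mul_of_nonneg_left (hle k) (hv k).le
        _ = V + V * ∑ k ∈ Q, f k ^ p * v k := by
          rw [mul_sum, hVdef, ← sum_add_distrib]
          refine sum_congr rfl fun k _ => ?_
          rw [htp]; ring
        _ ≤ V + V * 1 := by gcongr
        _ = V * 2 := by ring
    exact le_of_mul_le_mul_left this hV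
  simp only [htδ]
  have hsum0 : 0 ≤ ∑ k ∈ Q, v k * f k ^ p * bump (t k ^ δ) := sum_nonneg fun k _ => by
    have := bump_nonneg (Real.rpow_nonneg (ht0 k) δ)
    have := hf k
    have := hv k
    positivity
  rcases ha0.eq_or_lt with h0 | h0
  · rw [← h0, Real.zero_rpow (by linarith)]
    positivity
  -- Halving gives b ≤ 1 and a b^(r-1) = 2 b^r, so averaging the pointwise bound costs only one of
  -- the two copies of b^r.
  set b := a / 2 with hb
  have hb0 : 0 < b := by positivity
  have hkey : V * (2 * b ^ r) ≤ V * (4 * (∑ k ∈ Q, v k * f k ^ p * bump (t k ^ δ)) + b ^ r) := by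
    have hbr : b ^ r = b * b ^ (r - 1) := by
      rw [← Real.rpow_one_add' hb0.le (by linarith)]; congr 1; ring
    calc V * (2 * b ^ r) = (V * a) * b ^ (r - 1) := by rw [hbr, hb]; ring
      _ = ∑ k ∈ Q, v k * (t k * b ^ (r - 1)) := by
        rw [hVa, sum_mul]; exact sum_congr rfl fun k _ => by ring
      _ ≤ ∑ k ∈ Q, v k * (4 * (t k ^ p * bump (t k ^ δ)) + b ^ r) :=
        sum_le_sum fun k _ => mul_le_mul_of_nonneg_left
          (mul_rpow_le_bump hδ hδp hr (ht0 k) hb0 (by linarith)) (hv k).le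
      _ = _ := by
        have e : V * b ^ r = ∑ k ∈ Q, v k * b ^ r := by rw [hVdef, sum_mul]
        rw [mul_add, e, mul_sum, mul_sum, ← sum_add_distrib]
        refine sum_congr rfl fun k _ => ?_
        rw [htp]; ring
  have h2 := le_of_mul_le_mul_left hkey hV
  have h3 : a ^ r = 2 ^ r * b ^ r := by
    rw [← Real.mul_rpow (by norm_num) hb0.le, hb]; congr 1; ring
  rw [h3, mul_assoc]
  gcongr
  linarith

/-! ### Intervals, masses and the A_∞ condition -/

theorem card_symInterval (m : ℤ) (N : ℕ) : (symInterval m N).card = 2 * N + 1 := by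
  rw [symInterval, Int.card_Icc]; omega

theorem symInterval_nonempty (m : ℤ) (N : ℕ) : (symInterval m N).Nonempty :=
  ⟨m, mem_symInterval.2 (by simp)⟩

theorem mem_symInterval_comm {m k : ℤ} {N : ℕ} : k ∈ symInterval m N ↔ m ∈ symInterval k N := by
  rw [mem_symInterval, mem_symInterval, abs_sub_comm]

theorem symInterval_subset {m k : ℤ} {N : ℕ} (h : k ∈ symInterval m N) :
    symInterval k N ⊆ symInterval m (2 * N) := by
  intro i hi
  simp only [symInterval, mem_Icc] at *
  push_cast
  omega

theorem symInterval_mono {m : ℤ} {N N' : ℕ} (h : N ≤ N') :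
    symInterval m N ⊆ symInterval m N' := by
  intro i hi
  simp only [symInterval, mem_Icc] at *
  omega

/-- The total mass of a weight on `S_{m,N}`. -/
noncomputable def mass (v : ℤ → ℝ) (m : ℤ) (N : ℕ) : ℝ := ∑ k ∈ symInterval m N, v k

theorem mass_pos {v : ℤ → ℝ} (hv : ∀ k, 0 < v k) (m : ℤ) (N : ℕ) : 0 < mass v m N :=
  sum_pos (fun k _ => hv k) (symInterval_nonempty m N)

/-- A form of the `A_∞` condition: subsets of an interval with at least two fifths of its points
carry at least the fraction `c` of its mass. -/
def AInfty (c : ℝ) (v : ℤ → ℝ) : Prop :=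
  ∀ (m : ℤ) (N : ℕ) (E : Finset ℤ), E ⊆ symInterval m N →
    2 * (symInterval m N).card ≤ 5 * E.card → c * mass v m N ≤ ∑ k ∈ E, v k

theorem AInfty.doubling {c : ℝ} {v : ℤ → ℝ} (h : AInfty c v) (m : ℤ) (N : ℕ) :
    c * mass v m (2 * N) ≤ mass v m N :=
  h m (2 * N) (symInterval m N) (symInterval_mono (by omega)) (by
    simp only [card_symInterval]; omega)

/-- The annulus left by removing the inner interval has 2N of the 4N + 1 points. The worst case N =
1 has 2 of 5, which is where the fraction two fifths comes from. -/
theorem AInfty.reverse_doubling {c : ℝ} {v : ℤ → ℝ} (hv : ∀ k, 0 < v k) (hc : 0 < c)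
    (h : AInfty c v) (m : ℤ) {N : ℕ} (hN : 1 ≤ N) :
    (1 + c) * mass v m N ≤ mass v m (2 * N) := by
  have hsub : symInterval m N ⊆ symInterval m (2 * N) := symInterval_mono (by omega)
  have h1 := h m (2 * N) (symInterval m (2 * N) \ symInterval m N) sdiff_subset (by
    rw [card_sdiff_of_subset hsub]; simp only [card_symInterval]; omega)
  have h2 := sum_sdiff (f := v) hsub
  have h3 : mass v m N ≤ mass v m (2 * N) :=
    sum_le_sum_of_subset_of_nonneg hsub fun k _ _ => (hv k).le
  unfold mass at *
  nlinarith

theorem AInfty.sum_bump_mass_le {c : ℝ} {v : ℤ → ℝ} (hv : ∀ k, 0 < v k) (hc : 0 < c)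
    (h : AInfty c v) {ε : ℝ} (hε : 0 < ε) {z : ℝ} (hz : 0 ≤ z) (y : ℤ) (L : ℕ) :
    ∑ n ∈ range L, bump ((z * mass v y (2 ^ (n + 1))) ^ ε) ≤
      (1 + c) ^ ε / ((1 + c) ^ ε - 1) := by
  refine sum_bump_le (Real.one_lt_rpow (by linarith) hε) (fun n => ?_) (fun n => ?_) L
  · have := mass_pos hv y (2 ^ (n + 1))
    positivity
  · have h0 := mass_pos hv y (2 ^ (n + 1))
    rw [← Real.mul_rpow (by positivity) (by positivity)]
    have h1 := h.reverse_doubling hv hc y (N := 2 ^ (n + 1)) Nat.one_le_two_pow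
    refine Real.rpow_le_rpow (by positivity) ?_ hε.le
    calc (1 + c) * (z * mass v y (2 ^ (n + 1))) = z * ((1 + c) * mass v y (2 ^ (n + 1))) := by ring
      _ ≤ z * mass v y (2 * 2 ^ (n + 1)) := by gcongr
      _ = _ := by rw [pow_succ' 2 (n + 1)]

/-- Doubling makes the masses of intervals of one radius comparable when each contains the other's
centre, so in the embedding every interval through y can be replaced by the one centred at y. -/
theorem AInfty.bump_mass_le {c : ℝ} {v : ℤ → ℝ} (hv : ∀ k, 0 < v k) (hc : 0 < c) (hc1 : c ≤ 1)
    (h : AInfty c v) {ε : ℝ} (hε : 0 < ε) {z : ℝ} (hz : 0 ≤ z) {y m : ℤ} {N : ℕ}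
    (hm : m ∈ symInterval y N) :
    bump ((z * mass v m N) ^ ε) ≤ (c⁻¹ ^ ε) ^ 3 * bump ((z * mass v y N) ^ ε) := by
  have hcomp : ∀ {a b : ℤ}, a ∈ symInterval b N → mass v a N ≤ c⁻¹ * mass v b N := by
    intro a b hab
    have h1 : mass v a N ≤ mass v b (2 * N) :=
      sum_le_sum_of_subset_of_nonneg (symInterval_subset hab) fun k _ _ => (hv k).le
    have h2 := h.doubling b N
    rw [inv_mul_eq_div, le_div_iff₀ hc]
    nlinarith
  have hmy := hcomp hm
  have hym := hcomp (mem_symInterval_comm.1 hm)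
  have hm0 := mass_pos hv m N
  have hy0 := mass_pos hv y N
  refine bump_le_mul_bump (by positivity) (by positivity)
    (Real.one_le_rpow ((one_le_inv₀ hc).2 hc1) hε.le) ?_ ?_
  · rw [← Real.mul_rpow (by positivity) (by positivity)]
    refine Real.rpow_le_rpow (by positivity) ?_ hε.le
    calc z * mass v m N ≤ z * (c⁻¹ * mass v y N) := by gcongr
      _ = _ := by ring
  · rw [← Real.mul_rpow (by positivity) (by positivity)]
    refine Real.rpow_le_rpow (by positivity) ?_ hε.le
    calc z * mass v y N ≤ z * (c⁻¹ * mass v m N) := by gcongr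
      _ = _ := by ring

/-! ### The embedding over all scales and positions -/

/-- The off-diagonal Carleson embedding `L^p(v) → ℓ^r`, `r > p`, over all scales and positions. -/
theorem AInfty.embedding {c : ℝ} {v : ℤ → ℝ} (hv : ∀ k, 0 < v k) (hc : 0 < c) (hc1 : c ≤ 1)
    (h : AInfty c v) {p r : ℝ} (hp : 1 < p) (hr : p < r) :
    ∃ C : ℝ, ∀ (f : ℤ → ℝ) (A : Finset ℤ), (∀ k, 0 ≤ f k) → (∀ k ∉ A, f k = 0) →
      ∑ k ∈ A, f k ^ p * v k ≤ 1 → ∀ (L : ℕ) (M : Finset ℤ),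
      ∑ n ∈ range L, ∑ m ∈ M, ((2 : ℝ) ^ n)⁻¹ * (mass v m (2 ^ (n + 1)) ^ (1 / p - 1) *
        ∑ k ∈ symInterval m (2 ^ (n + 1)), f k * v k) ^ r ≤ C := by
  obtain ⟨δ, hδ, hδp, hδr⟩ : ∃ δ : ℝ, 0 < δ ∧ δ ≤ p - 1 ∧ p + δ ≤ r :=
    ⟨min (p - 1) (r - p), lt_min (by linarith) (by linarith), min_le_left _ _, by
      have := min_le_right (p - 1) (r - p); linarith⟩
  set ε := δ / p with hεd
  have hε : 0 < ε := by positivity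
  set G := (1 + c) ^ ε / ((1 + c) ^ ε - 1) with hG
  set B := (c⁻¹ ^ ε) ^ 3 with hB
  refine ⟨2 ^ r * 4 * (5 * B * G), fun f A hf hfA h1 L M => ?_⟩
  have hG0 : 0 ≤ G := by
    have : 1 < (1 + c) ^ ε := Real.one_lt_rpow (by linarith) hε
    exact div_nonneg (by linarith) (by linarith)
  have hB0 : 0 ≤ B := by positivity
  have hsub : ∀ Q : Finset ℤ, ∀ F : ℤ → ℝ, (∀ k, 0 ≤ F k) → (∀ k ∉ A, F k = 0) →
      ∑ k ∈ Q, F k ≤ ∑ k ∈ A, F k := by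
    intro Q F hF hFA
    have : ∑ k ∈ A ∪ Q, F k = ∑ k ∈ A, F k :=
      (sum_subset subset_union_left fun k _ hk => hFA k hk).symm
    rw [← this]
    exact sum_le_sum_of_subset_of_nonneg subset_union_right fun k _ _ => hF k
  have hfp : ∀ k, 0 ≤ f k ^ p := fun k => Real.rpow_nonneg (hf k) p
  have hfpA : ∀ k ∉ A, f k ^ p = 0 := fun k hk => by
    rw [hfA k hk, Real.zero_rpow (by linarith)]
  set Ψ : ℤ → ℤ → ℕ → ℝ := fun k m n =>
    v k * f k ^ p * bump ((f k ^ p * mass v m (2 ^ (n + 1))) ^ ε) with hΨ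
  have hΨ0 : ∀ k m n, 0 ≤ Ψ k m n := fun k m n => by
    have := hv k
    have := hfp k
    have := mass_pos hv m (2 ^ (n + 1))
    have := bump_nonneg (u := (f k ^ p * mass v m (2 ^ (n + 1))) ^ ε) (by positivity)
    simp only [hΨ]
    positivity
  have hone : ∀ m n, (mass v m (2 ^ (n + 1)) ^ (1 / p - 1) *
      ∑ k ∈ symInterval m (2 ^ (n + 1)), f k * v k) ^ r ≤
      2 ^ r * 4 * ∑ k ∈ symInterval m (2 ^ (n + 1)), Ψ k m n := fun m n =>
    rpow_mean_le_sum_bump hv hf (symInterval_nonempty _ _) hδ hδp hδr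
      ((hsub _ (fun k => f k ^ p * v k) (fun k => mul_nonneg (hfp k) (hv k).le)
        (fun k hk => by simp only [hfpA k hk, zero_mul])).trans h1)
  have hswap : ∀ n, ∑ m ∈ M, ∑ k ∈ symInterval m (2 ^ (n + 1)), Ψ k m n ≤
      ∑ k ∈ A, ∑ m ∈ symInterval k (2 ^ (n + 1)), Ψ k m n := by
    intro n
    have e1 : ∀ m, ∑ k ∈ symInterval m (2 ^ (n + 1)), Ψ k m n ≤
        ∑ k ∈ A, if k ∈ symInterval m (2 ^ (n + 1)) then Ψ k m n else 0 := by
      intro m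
      calc ∑ k ∈ symInterval m (2 ^ (n + 1)), Ψ k m n
          = ∑ k ∈ symInterval m (2 ^ (n + 1)),
            if k ∈ symInterval m (2 ^ (n + 1)) then Ψ k m n else 0 :=
            sum_congr rfl fun k hk => by rw [if_pos hk]
        _ ≤ _ := hsub _ _ (fun k => by split_ifs; exacts [hΨ0 _ _ _, le_rfl]) (fun k hk => by
            simp only [hΨ, hfpA k hk, mul_zero, zero_mul, ite_self])
    calc _ ≤ ∑ m ∈ M, ∑ k ∈ A, if k ∈ symInterval m (2 ^ (n + 1)) then Ψ k m n else 0 :=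
          sum_le_sum fun m _ => e1 m
      _ = ∑ k ∈ A, ∑ m ∈ M, if k ∈ symInterval m (2 ^ (n + 1)) then Ψ k m n else 0 := sum_comm
      _ ≤ _ := sum_le_sum fun k _ => by
          rw [← sum_filter]
          refine sum_le_sum_of_subset_of_nonneg (fun m hm => ?_) fun m _ _ => hΨ0 k m n
          exact mem_symInterval_comm.1 (mem_filter.1 hm).2
  -- At most 5·2^n centres see a given point at this scale; this count cancels the weight 2^(-n) of
  -- the scale.
  have hin : ∀ k n, ∑ m ∈ symInterval k (2 ^ (n + 1)), Ψ k m n ≤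
      (5 * 2 ^ n) * (B * Ψ k k n) := by
    intro k n
    have hterm : ∀ m ∈ symInterval k (2 ^ (n + 1)), Ψ k m n ≤ B * Ψ k k n := fun m hm => by
      have := h.bump_mass_le hv hc hc1 hε (hfp k) hm
      have hvk := hv k
      have hfk := hfp k
      calc Ψ k m n ≤ v k * f k ^ p *
            (B * bump ((f k ^ p * mass v k (2 ^ (n + 1))) ^ ε)) := by
            simp only [hΨ]; gcongr
        _ = _ := by simp only [hΨ]; ring
    refine (sum_le_card_nsmul _ _ _ hterm).trans ?_
    rw [nsmul_eq_mul, card_symInterval]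
    have : 0 ≤ B * Ψ k k n := mul_nonneg hB0 (hΨ0 _ _ _)
    gcongr
    push_cast
    have : (1 : ℝ) ≤ 2 ^ n := one_le_pow₀ (by norm_num)
    rw [pow_succ]
    linarith
  calc _ ≤ ∑ n ∈ range L, ((2 : ℝ) ^ n)⁻¹ * (2 ^ r * 4 *
        ∑ k ∈ A, (5 * 2 ^ n) * (B * Ψ k k n)) := by
        refine sum_le_sum fun n _ => ?_
        rw [← mul_sum]
        gcongr
        calc _ ≤ ∑ m ∈ M, 2 ^ r * 4 * ∑ k ∈ symInterval m (2 ^ (n + 1)), Ψ k m n :=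
              sum_le_sum fun m _ => hone m n
          _ = 2 ^ r * 4 * ∑ m ∈ M, ∑ k ∈ symInterval m (2 ^ (n + 1)), Ψ k m n := by
              rw [mul_sum]
          _ ≤ _ := by
              gcongr
              exact (hswap n).trans (sum_le_sum fun k _ => hin k n)
    _ = 2 ^ r * 4 * (5 * B) * ∑ k ∈ A, v k * f k ^ p *
        ∑ n ∈ range L, bump ((f k ^ p * mass v k (2 ^ (n + 1))) ^ ε) := by
        simp only [mul_sum]
        rw [sum_comm]
        refine sum_congr rfl fun k _ => sum_congr rfl fun n _ => ?_
        have : (2 : ℝ) ^ n ≠ 0 := by positivity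
        simp only [hΨ]
        field_simp
    _ ≤ 2 ^ r * 4 * (5 * B) * ∑ k ∈ A, v k * f k ^ p * G := by
        gcongr with k hk
        · have := hv k
          have := hfp k
          positivity
        · exact h.sum_bump_mass_le hv hc hε (hfp k) k L
    _ = 2 ^ r * 4 * (5 * B * G) * ∑ k ∈ A, f k ^ p * v k := by
        simp only [mul_sum]
        exact sum_congr rfl fun k _ => by ring
    _ ≤ 2 ^ r * 4 * (5 * B * G) * 1 := by gcongr
    _ = _ := mul_one _

/-! ### A_∞ from a pair of dual weights -/

/-- Hölder gives |E| ≤ u(E)^θ v(E)^(1-θ) ≤ u(E)^θ v(S)^(1-θ). Multiplying by u(S)^θ and using the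
bound on S yields u(E)/u(S) ≥ (|E|/(K|S|))^(1/θ). -/
theorem exists_aInfty {u v : ℤ → ℝ} (hu : ∀ k, 0 < u k) (hv : ∀ k, 0 < v k) {θ K : ℝ}
    (hθ0 : 0 < θ) (hθ1 : θ < 1) (huv : ∀ k, u k ^ θ * v k ^ (1 - θ) = 1) (hK : 0 < K)
    (h : ∀ m N, mass u m N ^ θ * mass v m N ^ (1 - θ) ≤ K * ((symInterval m N).card : ℝ)) :
    ∃ c, 0 < c ∧ c ≤ 1 ∧ AInfty c u := by
  set c₀ : ℝ := (2 / (5 * K)) ^ θ⁻¹ with hc₀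
  have hc₀0 : 0 < c₀ := by positivity
  refine ⟨min 1 c₀, lt_min one_pos hc₀0, min_le_left _ _, fun m N E hE hcard => ?_⟩
  have hmu := mass_pos hu m N
  have hmv := mass_pos hv m N
  have hE0 : 0 ≤ ∑ k ∈ E, u k := sum_nonneg fun k _ => (hu k).le
  refine (mul_le_mul_of_nonneg_right (min_le_right 1 c₀) hmu.le).trans ?_
  have hol : (E.card : ℝ) ≤ (∑ k ∈ E, u k) ^ θ * (∑ k ∈ E, v k) ^ (1 - θ) := by
    have := Real.inner_le_Lp_mul_Lq_of_nonneg E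
      (Real.HolderConjugate.inv_inv hθ0 (sub_pos.2 hθ1) (by ring))
      (f := fun k => u k ^ θ) (g := fun k => v k ^ (1 - θ))
      (fun k _ => Real.rpow_nonneg (hu k).le _) (fun k _ => Real.rpow_nonneg (hv k).le _)
    simp only [huv, sum_const, nsmul_eq_mul, mul_one, one_div, inv_inv] at this
    refine this.trans (le_of_eq ?_)
    congr 2
    · exact sum_congr rfl fun k _ => Real.rpow_rpow_inv (hu k).le hθ0.ne'
    · exact sum_congr rfl fun k _ => Real.rpow_rpow_inv (hv k).le (by linarith)
  have hvE : ∑ k ∈ E, v k ≤ mass v m N :=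
    sum_le_sum_of_subset_of_nonneg hE fun k _ _ => (hv k).le
  have hvE0 : 0 ≤ ∑ k ∈ E, v k := sum_nonneg fun k _ => (hv k).le
  have hS : (0 : ℝ) < (symInterval m N).card := by
    exact_mod_cast (symInterval_nonempty m N).card_pos
  have h25 : 2 * ((symInterval m N).card : ℝ) ≤ 5 * E.card := by exact_mod_cast hcard
  rw [← Real.rpow_le_rpow_iff (by positivity) hE0 hθ0, Real.mul_rpow hc₀0.le hmu.le, hc₀,
    Real.rpow_inv_rpow (by positivity) hθ0.ne', div_mul_eq_mul_div, div_le_iff₀ (by positivity)]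
  have h1 : (E.card : ℝ) ≤ (∑ k ∈ E, u k) ^ θ * mass v m N ^ (1 - θ) := by
    refine hol.trans ?_
    have : 0 ≤ 1 - θ := by linarith
    gcongr
  have h2 : (symInterval m N).card * (2 * mass u m N ^ θ) ≤
      (symInterval m N).card * ((∑ k ∈ E, u k) ^ θ * (5 * K)) := by
    calc (symInterval m N).card * (2 * mass u m N ^ θ)
        = mass u m N ^ θ * (2 * (symInterval m N).card) := by ring
      _ ≤ mass u m N ^ θ * (5 * ((∑ k ∈ E, u k) ^ θ * mass v m N ^ (1 - θ))) := by
          have : 2 * ((symInterval m N).card : ℝ) ≤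
              5 * ((∑ k ∈ E, u k) ^ θ * mass v m N ^ (1 - θ)) := by linarith
          exact mul_le_mul_of_nonneg_left this (by positivity)
      _ = (∑ k ∈ E, u k) ^ θ * 5 * (mass u m N ^ θ * mass v m N ^ (1 - θ)) := by ring
      _ ≤ (∑ k ∈ E, u k) ^ θ * 5 * (K * (symInterval m N).card) := by
          have := h m N
          gcongr
      _ = _ := by ring
  exact le_of_mul_le_mul_left h2 hS

/-! ### Dyadic domination of the kernel and the bilinear form -/

/-- The kernel `|k - i|^{-β}` of the discrete Riesz potential, vanishing on the diagonal. -/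
noncomputable def kernel (β : ℝ) (k i : ℤ) : ℝ :=
  if i = k then 0 else (|(k : ℝ) - i| ^ β)⁻¹

theorem kernel_nonneg (β : ℝ) (k i : ℤ) : 0 ≤ kernel β k i := by
  unfold kernel; split_ifs <;> positivity

/-- If 2^n ≤ |k-i| < 2^(n+1), each of the |k-i| + 1 ≥ 2^n integers between k and i is the centre of
an interval of radius 2^(n+1) holding both; this single scale already gives 2^(-nβ) ≥ |k-i|^(-β).
Using every centre avoids shifted dyadic grids. -/
theorem kernel_le_sum {β : ℝ} (hβ : 0 ≤ β) {H : ℕ} {k i : ℤ} (hk : k ∈ symInterval 0 H)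
    (hi : i ∈ symInterval 0 H) :
    kernel β k i ≤ ∑ n ∈ range (2 * H + 1), ∑ m ∈ symInterval 0 H,
      if k ∈ symInterval m (2 ^ (n + 1)) ∧ i ∈ symInterval m (2 ^ (n + 1)) then
        ((2 : ℝ) ^ n)⁻¹ * (((2 : ℝ) ^ n) ^ β)⁻¹ else 0 := by
  by_cases hik : i = k
  · rw [kernel, if_pos hik]
    exact sum_nonneg fun n _ => sum_nonneg fun m _ => by split_ifs <;> positivity
  rw [kernel, if_neg hik]
  set d := (k - i).natAbs with hd
  have hd0 : d ≠ 0 := by omega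
  set n := Nat.log 2 d with hn
  have hlow : 2 ^ n ≤ d := Nat.pow_log_le_self 2 hd0
  have hup : d < 2 ^ (n + 1) := Nat.lt_pow_succ_log_self (by norm_num) d
  have hk' := hk
  have hi' := hi
  simp only [symInterval, mem_Icc] at hk' hi'
  have hnL : n ∈ range (2 * H + 1) := by
    have : n ≤ d := Nat.log_le_self 2 d
    rw [mem_range]; omega
  have habs : |(k : ℝ) - i| = d := by
    rw [hd, Nat.cast_natAbs]; push_cast; rfl
  refine le_trans ?_ (single_le_sum (f := fun n => ∑ m ∈ symInterval 0 H,
      if k ∈ symInterval m (2 ^ (n + 1)) ∧ i ∈ symInterval m (2 ^ (n + 1)) then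
        ((2 : ℝ) ^ n)⁻¹ * (((2 : ℝ) ^ n) ^ β)⁻¹ else 0)
      (fun n _ => sum_nonneg fun m _ => by split_ifs <;> positivity) hnL)
  rw [← sum_filter, sum_const, nsmul_eq_mul]
  have hcard : 2 ^ n ≤ ((symInterval 0 H).filter fun m =>
      k ∈ symInterval m (2 ^ (n + 1)) ∧ i ∈ symInterval m (2 ^ (n + 1))).card := by
    have hsub : Finset.Icc (min k i) (max k i) ⊆ (symInterval 0 H).filter fun m =>
        k ∈ symInterval m (2 ^ (n + 1)) ∧ i ∈ symInterval m (2 ^ (n + 1)) := by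
      intro m hm
      have hup' : (d : ℤ) < (2 ^ (n + 1) : ℕ) := by exact_mod_cast hup
      simp only [symInterval, mem_filter, mem_Icc] at *
      omega
    refine le_trans ?_ (card_le_card hsub)
    rw [Int.card_Icc]
    omega
  have h2 : (2 : ℝ) ^ n ≤ d := by exact_mod_cast hlow
  have hcard' : (2 : ℝ) ^ n ≤ (((symInterval 0 H).filter fun m =>
      k ∈ symInterval m (2 ^ (n + 1)) ∧ i ∈ symInterval m (2 ^ (n + 1))).card : ℝ) := by
    exact_mod_cast hcard
  rw [habs]
  calc ((d : ℝ) ^ β)⁻¹ ≤ (((2 : ℝ) ^ n) ^ β)⁻¹ := by gcongr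
    _ = (2 : ℝ) ^ n * (((2 : ℝ) ^ n)⁻¹ * (((2 : ℝ) ^ n) ^ β)⁻¹) := by
      rw [← mul_assoc, mul_inv_cancel₀ (by positivity), one_mul]
    _ ≤ _ := by gcongr

theorem form_le_sum {β : ℝ} (hβ : 0 ≤ β) (H : ℕ) {x y : ℤ → ℝ} (hx : ∀ k, 0 ≤ x k)
    (hy : ∀ k, 0 ≤ y k) :
    ∑ k ∈ symInterval 0 H, ∑ i ∈ symInterval 0 H, kernel β k i * x i * y k ≤
      ∑ n ∈ range (2 * H + 1), ∑ m ∈ symInterval 0 H,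
        ((2 : ℝ) ^ n)⁻¹ * (((2 : ℝ) ^ n) ^ β)⁻¹ *
          (mass x m (2 ^ (n + 1)) * mass y m (2 ^ (n + 1))) := by
  have hle : ∀ (z : ℤ → ℝ) (_ : ∀ k, 0 ≤ z k) (Q : Finset ℤ),
      ∑ k ∈ symInterval 0 H, (if k ∈ Q then z k else 0) ≤ ∑ k ∈ Q, z k := by
    intro z hz Q
    rw [← sum_filter]
    exact sum_le_sum_of_subset_of_nonneg (fun k hk => (mem_filter.1 hk).2) fun k _ _ => hz k
  calc _ ≤ ∑ k ∈ symInterval 0 H, ∑ i ∈ symInterval 0 H, ∑ n ∈ range (2 * H + 1),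
        ∑ m ∈ symInterval 0 H, ((2 : ℝ) ^ n)⁻¹ * (((2 : ℝ) ^ n) ^ β)⁻¹ *
          ((if i ∈ symInterval m (2 ^ (n + 1)) then x i else 0) *
            (if k ∈ symInterval m (2 ^ (n + 1)) then y k else 0)) := by
        refine sum_le_sum fun k hk => sum_le_sum fun i hi => ?_
        have h1 := mul_le_mul_of_nonneg_right (kernel_le_sum hβ hk hi)
          (mul_nonneg (hx i) (hy k))
        rw [← mul_assoc] at h1
        refine h1.trans (le_of_eq ?_)
        simp only [sum_mul]
        refine sum_congr rfl fun n _ => sum_congr rfl fun m _ => ?_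
        by_cases h1 : k ∈ symInterval m (2 ^ (n + 1)) <;>
          by_cases h2 : i ∈ symInterval m (2 ^ (n + 1)) <;> simp [h1, h2]
    _ = ∑ n ∈ range (2 * H + 1), ∑ m ∈ symInterval 0 H,
        ((2 : ℝ) ^ n)⁻¹ * (((2 : ℝ) ^ n) ^ β)⁻¹ *
          ((∑ i ∈ symInterval 0 H, if i ∈ symInterval m (2 ^ (n + 1)) then x i else 0) *
            ∑ k ∈ symInterval 0 H, if k ∈ symInterval m (2 ^ (n + 1)) then y k else 0) := by
        rw [sum_comm]
        simp only [sum_mul_sum]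
        simp only [mul_sum]
        simp_rw [sum_comm (s := symInterval 0 H) (t := range (2 * H + 1))]
        refine sum_congr rfl fun n _ => ?_
        rw [sum_congr rfl fun i _ => sum_comm, sum_comm]
    _ ≤ _ := by
        refine sum_le_sum fun n _ => sum_le_sum fun m _ => ?_
        have h1 := hle x hx (symInterval m (2 ^ (n + 1)))
        have h2 := hle y hy (symInterval m (2 ^ (n + 1)))
        have h3 : 0 ≤ ∑ k ∈ symInterval 0 H,
            if k ∈ symInterval m (2 ^ (n + 1)) then y k else 0 :=
          sum_nonneg fun k _ => by split_ifs; exacts [hy k, le_rfl]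
        have h4 : 0 ≤ ∑ k ∈ symInterval m (2 ^ (n + 1)), x k := sum_nonneg fun k _ => hx k
        unfold mass
        gcongr

/-- The hypothesis on intervals splits each term into an f-average times a g-average. Young's
inequality with r > p and s > t puts both in the off-diagonal range of the embedding. -/
theorem exists_form_le {β p t r s K c d : ℝ} {σ w : ℤ → ℝ} (hσ : ∀ k, 0 < σ k)
    (hw : ∀ k, 0 < w k) (hβ : 0 < β) (hp : 1 < p) (ht : 1 < t) (hr : p < r) (hs : t < s)
    (hrs : r.HolderConjugate s) (hK : 0 ≤ K) (hc : 0 < c) (hc1 : c ≤ 1) (hd : 0 < d) (hd1 : d ≤ 1)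
    (hσA : AInfty c σ) (hwA : AInfty d w)
    (h : ∀ m N, (((symInterval m N).card : ℝ) ^ β)⁻¹ ≤
      K * (mass σ m N ^ (1 / p - 1) * mass w m N ^ (1 / t - 1))) :
    ∃ C : ℝ, ∀ (H : ℕ) (f g : ℤ → ℝ), (∀ k, 0 ≤ f k) → (∀ k, 0 ≤ g k) →
      (∀ k ∉ symInterval 0 H, f k = 0) → (∀ k ∉ symInterval 0 H, g k = 0) →
      ∑ k ∈ symInterval 0 H, f k ^ p * σ k ≤ 1 → ∑ k ∈ symInterval 0 H, g k ^ t * w k ≤ 1 →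
      ∑ k ∈ symInterval 0 H, ∑ i ∈ symInterval 0 H,
        kernel β k i * (f i * σ i) * (g k * w k) ≤ C := by
  obtain ⟨C₁, hC₁⟩ := hσA.embedding hσ hc hc1 hp hr
  obtain ⟨C₂, hC₂⟩ := hwA.embedding hw hd hd1 ht hs
  refine ⟨5 ^ β * K * (C₁ / r + C₂ / s), fun H f g hf hg hfH hgH hf1 hg1 => ?_⟩
  refine (form_le_sum hβ.le H (fun k => mul_nonneg (hf k) (hσ k).le)
    (fun k => mul_nonneg (hg k) (hw k).le)).trans ?_
  have b₁ := hC₁ f _ hf hfH hf1 (2 * H + 1) (symInterval 0 H)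
  have b₂ := hC₂ g _ hg hgH hg1 (2 * H + 1) (symInterval 0 H)
  have hr0 : 0 < r := by linarith
  have hs0 : 0 < s := by linarith
  set a : ℕ → ℤ → ℝ := fun n m => mass σ m (2 ^ (n + 1)) ^ (1 / p - 1) *
    ∑ k ∈ symInterval m (2 ^ (n + 1)), f k * σ k with ha
  set b : ℕ → ℤ → ℝ := fun n m => mass w m (2 ^ (n + 1)) ^ (1 / t - 1) *
    ∑ k ∈ symInterval m (2 ^ (n + 1)), g k * w k with hb
  calc _ ≤ ∑ n ∈ range (2 * H + 1), ∑ m ∈ symInterval 0 H,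
        5 ^ β * K * (((2 : ℝ) ^ n)⁻¹ * (a n m) ^ r / r + ((2 : ℝ) ^ n)⁻¹ * (b n m) ^ s / s) := by
        refine sum_le_sum fun n _ => sum_le_sum fun m _ => ?_
        have hX : 0 ≤ mass (fun k => f k * σ k) m (2 ^ (n + 1)) :=
          sum_nonneg fun k _ => mul_nonneg (hf k) (hσ k).le
        have hY : 0 ≤ mass (fun k => g k * w k) m (2 ^ (n + 1)) :=
          sum_nonneg fun k _ => mul_nonneg (hg k) (hw k).le
        have hmσ := mass_pos hσ m (2 ^ (n + 1))
        have hmw := mass_pos hw m (2 ^ (n + 1))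
        have ha0 : 0 ≤ a n m := mul_nonneg (by positivity) hX
        have hb0 : 0 ≤ b n m := mul_nonneg (by positivity) hY
        have hyoung := Real.young_inequality_of_nonneg ha0 hb0 hrs
        have hcard : (((2 : ℝ) ^ n) ^ β)⁻¹ ≤
            5 ^ β * (((symInterval m (2 ^ (n + 1))).card : ℝ) ^ β)⁻¹ := by
          rw [card_symInterval, ← div_eq_mul_inv, inv_eq_one_div,
            div_le_div_iff₀ (by positivity) (by positivity), one_mul,
            ← Real.mul_rpow (by norm_num) (by positivity)]
          refine Real.rpow_le_rpow (by positivity) ?_ hβ.le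
          push_cast
          have : (1 : ℝ) ≤ 2 ^ n := one_le_pow₀ (by norm_num)
          rw [pow_succ]
          linarith
        calc _ ≤ ((2 : ℝ) ^ n)⁻¹ * (5 ^ β * (K * (mass σ m (2 ^ (n + 1)) ^ (1 / p - 1) *
              mass w m (2 ^ (n + 1)) ^ (1 / t - 1)))) *
              (mass (fun k => f k * σ k) m (2 ^ (n + 1)) *
                mass (fun k => g k * w k) m (2 ^ (n + 1))) := by
              have := h m (2 ^ (n + 1))
              gcongr
              exact hcard.trans (by gcongr)
          _ = 5 ^ β * K * (((2 : ℝ) ^ n)⁻¹ * (a n m * b n m)) := by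
              simp only [ha, hb, mass]; ring
          _ ≤ 5 ^ β * K * (((2 : ℝ) ^ n)⁻¹ * (a n m ^ r / r + b n m ^ s / s)) := by gcongr
          _ = _ := by ring
    _ = 5 ^ β * K * ((∑ n ∈ range (2 * H + 1), ∑ m ∈ symInterval 0 H,
          ((2 : ℝ) ^ n)⁻¹ * (a n m) ^ r) / r + (∑ n ∈ range (2 * H + 1), ∑ m ∈ symInterval 0 H,
          ((2 : ℝ) ^ n)⁻¹ * (b n m) ^ s) / s) := by
        simp only [← mul_sum, sum_add_distrib, ← sum_div]
    _ ≤ _ := by gcongr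

/-! ### From the bilinear form on boxes to boundedness on ℤ -/

theorem classA_iff {p q β : ℝ} (hβ : 1 / q + 1 / (p / (p - 1)) = β) {ω : ℤ → ℝ}
    (hω : ∀ k, 0 < ω k) :
    ClassA p q ω ↔ ∃ K : ℝ, ∀ m N, mass (fun k => ω k ^ q) m N ^ (1 / q) *
      mass (fun k => ω k ^ (-(p / (p - 1)))) m N ^ (1 / (p / (p - 1))) ≤
      K * ((symInterval m N).card : ℝ) ^ β := by
  have key : ∀ m N, average (fun k => ω k ^ q) m N ^ (1 / q) *
      average (fun k => ω k ^ (-(p / (p - 1)))) m N ^ (1 / (p / (p - 1))) =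
      mass (fun k => ω k ^ q) m N ^ (1 / q) *
      mass (fun k => ω k ^ (-(p / (p - 1)))) m N ^ (1 / (p / (p - 1))) /
      ((symInterval m N).card : ℝ) ^ β := by
    intro m N
    have hS : (0 : ℝ) < (symInterval m N).card := by
      exact_mod_cast (symInterval_nonempty m N).card_pos
    have h1 := mass_pos (v := fun k => ω k ^ q) (fun k => Real.rpow_pos_of_pos (hω k) _) m N
    have h2 := mass_pos (v := fun k => ω k ^ (-(p / (p - 1))))
      (fun k => Real.rpow_pos_of_pos (hω k) _) m N
    have e : ∀ v, average v m N = mass v m N / ((symInterval m N).card : ℝ) := fun _ => rfl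
    rw [e, e, Real.div_rpow h1.le hS.le, Real.div_rpow h2.le hS.le, div_mul_div_comm,
      ← Real.rpow_add hS, hβ]
  have hS : ∀ m N, (0 : ℝ) < ((symInterval m N).card : ℝ) ^ β := fun m N => by
    have : (0 : ℝ) < (symInterval m N).card := by
      exact_mod_cast (symInterval_nonempty m N).card_pos
    positivity
  constructor
  · rintro ⟨K, hK⟩
    refine ⟨K, fun m N => ?_⟩
    have := hK ⟨(m, N), rfl⟩
    simp only [key] at this
    rwa [div_le_iff₀ (hS m N)] at this
  · rintro ⟨K, hK⟩
    refine ⟨K, ?_⟩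
    rintro _ ⟨⟨m, N⟩, rfl⟩
    simp only [key]
    rw [div_le_iff₀ (hS m N)]
    exact hK m N

/-- Duality with the extremal choice: f is x/σ and g is U^(q-1), U being the truncated potential,
each divided by its norm on the box. -/
theorem rpow_sum_le_of_form_le {β p q t C : ℝ} {σ w : ℤ → ℝ} (hσ : ∀ k, 0 < σ k)
    (hw : ∀ k, 0 < w k) (hp : 1 < p) (hqt : q.HolderConjugate t) (hC : 0 ≤ C) {H : ℕ}
    (h : ∀ f g : ℤ → ℝ, (∀ k, 0 ≤ f k) → (∀ k, 0 ≤ g k) →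
      (∀ k ∉ symInterval 0 H, f k = 0) → (∀ k ∉ symInterval 0 H, g k = 0) →
      ∑ k ∈ symInterval 0 H, f k ^ p * σ k ≤ 1 → ∑ k ∈ symInterval 0 H, g k ^ t * w k ≤ 1 →
      ∑ k ∈ symInterval 0 H, ∑ i ∈ symInterval 0 H,
        kernel β k i * (f i * σ i) * (g k * w k) ≤ C)
    {x : ℤ → ℝ} (hx : ∀ k, 0 ≤ x k) :
    (∑ k ∈ symInterval 0 H, (∑ i ∈ symInterval 0 H, kernel β k i * x i) ^ q * w k) ^ (1 / q) ≤
      C * (∑ k ∈ symInterval 0 H, x k ^ p * σ k ^ (1 - p)) ^ (1 / p) := by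
  set S := symInterval 0 H with hS
  set U : ℤ → ℝ := fun k => ∑ i ∈ S, kernel β k i * x i with hU
  have hU0 : ∀ k, 0 ≤ U k := fun k => sum_nonneg fun i _ => mul_nonneg (kernel_nonneg _ _ _) (hx i)
  set Z := ∑ k ∈ S, U k ^ q * w k with hZ
  set P := ∑ k ∈ S, x k ^ p * σ k ^ (1 - p) with hP
  have hq0 : 0 < q := hqt.pos
  have ht0 : 0 < t := hqt.symm.pos
  have hp0 : 0 < p := by linarith
  have hZ0 : 0 ≤ Z := sum_nonneg fun k _ => mul_nonneg (Real.rpow_nonneg (hU0 k) _) (hw k).le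
  have hPt : ∀ k ∈ S, 0 ≤ x k ^ p * σ k ^ (1 - p) := fun k _ =>
    mul_nonneg (Real.rpow_nonneg (hx k) _) (Real.rpow_nonneg (hσ k).le _)
  have hP0 : 0 ≤ P := sum_nonneg hPt
  change Z ^ (1 / q) ≤ C * P ^ (1 / p)
  rcases hZ0.eq_or_lt with hZe | hZpos
  · rw [← hZe, Real.zero_rpow (by positivity)]
    positivity
  have hPpos : 0 < P := by
    rcases hP0.eq_or_lt with hPe | hPpos
    · exfalso
      have hx0 : ∀ k ∈ S, x k = 0 := fun k hk => by
        have := (sum_eq_zero_iff_of_nonneg hPt).1 hPe.symm k hk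
        have hσk : σ k ^ (1 - p) ≠ 0 := (Real.rpow_pos_of_pos (hσ k) _).ne'
        exact (Real.rpow_eq_zero (hx k) hp0.ne').1 ((mul_eq_zero.1 this).resolve_right hσk)
      have hUz : ∀ k, U k = 0 := fun k => sum_eq_zero fun i hi => by rw [hx0 i hi, mul_zero]
      have : Z = 0 := sum_eq_zero fun k _ => by rw [hUz, Real.zero_rpow hq0.ne', zero_mul]
      linarith
    · exact hPpos
  have hPp : 0 < P ^ (1 / p) := by positivity
  have hZt : 0 < Z ^ (1 / t) := by positivity
  have hf : ∀ k, 0 ≤ x k / σ k / P ^ (1 / p) := fun k => by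
    have := hx k
    have := hσ k
    positivity
  have hg : ∀ k, 0 ≤ U k ^ (q - 1) / Z ^ (1 / t) := fun k => by
    have := hU0 k
    positivity
  have hform := h (fun k => if k ∈ S then x k / σ k / P ^ (1 / p) else 0)
    (fun k => if k ∈ S then U k ^ (q - 1) / Z ^ (1 / t) else 0)
    (fun k => by split_ifs; exacts [hf k, le_rfl]) (fun k => by split_ifs; exacts [hg k, le_rfl])
    (fun k hk => if_neg hk) (fun k hk => if_neg hk) ?_ ?_
  · have e : ∑ k ∈ S, ∑ i ∈ S, kernel β k i *
        ((if i ∈ S then x i / σ i / P ^ (1 / p) else 0) * σ i) *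
        ((if k ∈ S then U k ^ (q - 1) / Z ^ (1 / t) else 0) * w k) =
        Z / (Z ^ (1 / t) * P ^ (1 / p)) := by
      rw [hZ, sum_div]
      refine sum_congr rfl fun k hk => ?_
      have hUq : U k ^ q = U k ^ (q - 1) * U k := by
        rw [← Real.rpow_add_one' (hU0 k) (by linarith)]; congr 1; ring
      rw [if_pos hk, ← sum_mul, hUq]
      have : ∑ i ∈ S, kernel β k i * ((if i ∈ S then x i / σ i / P ^ (1 / p) else 0) * σ i) =
          U k / P ^ (1 / p) := by
        rw [hU, sum_div]
        refine sum_congr rfl fun i hi => ?_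
        have := (hσ i).ne'
        rw [if_pos hi]
        field_simp
      rw [this]
      field_simp
    rw [e] at hform
    have hZe : Z = Z ^ (1 / q) * Z ^ (1 / t) := by
      rw [← Real.rpow_add hZpos, one_div, one_div, hqt.inv_add_inv_eq_one, Real.rpow_one]
    rw [div_le_iff₀ (mul_pos hZt hPp)] at hform
    refine le_of_mul_le_mul_right ?_ hZt
    rw [← hZe]
    linarith
  · refine le_of_eq ?_
    calc _ = ∑ k ∈ S, x k ^ p * σ k ^ (1 - p) / P := by
          refine sum_congr rfl fun k hk => ?_
          have hσk := hσ k
          rw [if_pos hk, Real.div_rpow (div_nonneg (hx k) hσk.le) hPp.le,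
            Real.div_rpow (hx k) hσk.le, ← Real.rpow_mul hP0, one_div, inv_mul_cancel₀ hp0.ne',
            Real.rpow_one, Real.rpow_sub hσk, Real.rpow_one]
          field_simp
      _ = 1 := by rw [← sum_div, ← hP, div_self hPpos.ne']
  · refine le_of_eq ?_
    calc _ = ∑ k ∈ S, U k ^ q * w k / Z := by
          refine sum_congr rfl fun k hk => ?_
          have hUk := hU0 k
          rw [if_pos hk, Real.div_rpow (Real.rpow_nonneg hUk _) hZt.le, ← Real.rpow_mul hUk,
            ← Real.rpow_mul hZ0, one_div, inv_mul_cancel₀ ht0.ne', Real.rpow_one,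
            hqt.sub_one_mul_conj]
          ring
      _ = 1 := by rw [← sum_div, ← hZ, div_self hZpos.ne']

theorem rieszTerm_eq (α : ℝ) (x : ℤ → ℝ) (k : ℤ) (i : {i : ℤ // i ≠ k}) :
    rieszTerm α x k i = kernel (1 - α) k i * x i := by
  rw [rieszTerm, kernel, if_neg i.2, div_eq_inv_mul]

theorem riesz_eq_tsum (α : ℝ) (x : ℤ → ℝ) (k : ℤ) :
    riesz α x k = ∑' i, kernel (1 - α) k i * x i := by
  simp only [riesz, rieszTerm_eq]
  rw [show (∑' i : {i : ℤ // i ≠ k}, kernel (1 - α) k i * x i) =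
    ∑' i : {i : ℤ | i ≠ k}, kernel (1 - α) k i * x i from rfl,
    tsum_subtype {i : ℤ | i ≠ k} (fun i => kernel (1 - α) k i * x i)]
  refine tsum_congr fun i => ?_
  by_cases hik : i = k <;> simp [Set.indicator, hik, kernel]

/-- Box bounds for |x| control finite sums in k of potentials over finite sets of i. This gives
absolute convergence at each k; then the inner sets exhaust ℤ, and afterwards the outer ones. -/
theorem rieszBounded_of_box {α p q C : ℝ} {v w : ℤ → ℝ} (hp : 1 < p) (hq : 1 < q) (hC : 0 < C)
    (hv : ∀ k, 0 < v k) (hw : ∀ k, 0 < w k)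
    (h : ∀ (H : ℕ) (x : ℤ → ℝ), (∀ k, 0 ≤ x k) →
      (∑ k ∈ symInterval 0 H, (∑ i ∈ symInterval 0 H, kernel (1 - α) k i * x i) ^ q * w k) ^
        (1 / q) ≤ C * (∑ k ∈ symInterval 0 H, x k ^ p * v k) ^ (1 / p)) :
    RieszBounded α p q v w := by
  refine ⟨C, hC, fun x hx => ?_⟩
  have hq0 : 0 < q := by linarith
  have hp0 : 0 < p := by linarith
  set κ := kernel (1 - α) with hκ
  have hκ0 : ∀ k i, 0 ≤ κ k i := kernel_nonneg _
  have ht0 : ∀ k, 0 ≤ |x k| ^ p * v k := fun k => mul_nonneg (by positivity) (hv k).le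
  set B := C * weightedNorm p v x with hB
  have hB0 : 0 ≤ B := mul_nonneg hC.le (Real.rpow_nonneg (tsum_nonneg ht0) _)
  have hfin : ∀ T A : Finset ℤ, ∑ k ∈ T, (∑ i ∈ A, κ k i * |x i|) ^ q * w k ≤ B ^ q := by
    intro T A
    obtain ⟨H, hH⟩ : ∃ H : ℕ, T ∪ A ⊆ symInterval 0 H := by
      refine ⟨(T ∪ A).sup Int.natAbs, fun k hk => ?_⟩
      have : k.natAbs ≤ (T ∪ A).sup Int.natAbs := le_sup (f := Int.natAbs) hk
      simp only [symInterval, mem_Icc]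
      omega
    have hT := subset_union_left.trans hH
    have hA := subset_union_right.trans hH
    have hterm : ∀ k, 0 ≤ (∑ i ∈ symInterval 0 H, κ k i * |x i|) ^ q * w k := fun k =>
      mul_nonneg (Real.rpow_nonneg (sum_nonneg fun i _ => mul_nonneg (hκ0 _ _) (abs_nonneg _)) _)
        (hw k).le
    calc _ ≤ ∑ k ∈ T, (∑ i ∈ symInterval 0 H, κ k i * |x i|) ^ q * w k := by
          refine sum_le_sum fun k _ => mul_le_mul_of_nonneg_right
            (Real.rpow_le_rpow ?_ ?_ hq0.le) (hw k).le
          · exact sum_nonneg fun i _ => mul_nonneg (hκ0 _ _) (abs_nonneg _)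
          · exact sum_le_sum_of_subset_of_nonneg hA fun i _ _ =>
              mul_nonneg (hκ0 _ _) (abs_nonneg _)
      _ ≤ ∑ k ∈ symInterval 0 H, (∑ i ∈ symInterval 0 H, κ k i * |x i|) ^ q * w k :=
          sum_le_sum_of_subset_of_nonneg hT fun k _ _ => hterm k
      _ ≤ B ^ q := by
          rw [← Real.rpow_inv_le_iff_of_pos (sum_nonneg fun k _ => hterm k) hB0 hq0, ← one_div]
          refine (h H (fun k => |x k|) fun k => abs_nonneg _).trans ?_
          have := hx.sum_le_tsum (symInterval 0 H) fun k _ => ht0 k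
          have h0 : 0 ≤ ∑ k ∈ symInterval 0 H, |x k| ^ p * v k := sum_nonneg fun k _ => ht0 k
          simp only [hB, weightedNorm]
          gcongr
  have hsum : ∀ k, Summable fun i => κ k i * |x i| := by
    intro k
    refine summable_of_sum_le (c := (B ^ q / w k) ^ q⁻¹)
      (fun i => mul_nonneg (hκ0 _ _) (abs_nonneg _)) fun A => ?_
    have h1 := hfin {k} A
    rw [sum_singleton, ← le_div_iff₀ (hw k)] at h1
    have h0 : 0 ≤ ∑ i ∈ A, κ k i * |x i| :=
      sum_nonneg fun i _ => mul_nonneg (hκ0 _ _) (abs_nonneg _)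
    rw [Real.le_rpow_inv_iff_of_pos h0 (div_nonneg (by positivity) (hw k).le) hq0]
    exact h1
  have habs : ∀ k i, ‖κ k i * x i‖ = κ k i * |x i| := fun k i => by
    rw [Real.norm_eq_abs, abs_mul, abs_of_nonneg (hκ0 k i)]
  have hle : ∀ k, |riesz α x k| ≤ ∑' i, κ k i * |x i| := fun k => by
    rw [riesz_eq_tsum, ← Real.norm_eq_abs]
    have := norm_tsum_le_tsum_norm (f := fun i => κ k i * x i) (by simpa only [habs] using hsum k)
    simpa only [habs] using this
  have hT : ∀ T : Finset ℤ, ∑ k ∈ T, |riesz α x k| ^ q * w k ≤ B ^ q := by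
    intro T
    refine (sum_le_sum fun k _ => mul_le_mul_of_nonneg_right
      (Real.rpow_le_rpow (abs_nonneg _) (hle k) hq0.le) (hw k).le).trans ?_
    refine le_of_tendsto (f := fun A : Finset ℤ =>
      ∑ k ∈ T, (∑ i ∈ A, κ k i * |x i|) ^ q * w k) (x := atTop) ?_
      (Eventually.of_forall fun A => hfin T A)
    exact tendsto_finsetSum _ fun k _ =>
      ((hsum k).hasSum.rpow_const (Or.inr hq0.le)).mul_const _
  have hr0 : ∀ k, 0 ≤ |riesz α x k| ^ q * w k := fun k => mul_nonneg (by positivity) (hw k).le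
  refine ⟨fun k => ?_, summable_of_sum_le hr0 hT, ?_⟩
  · have hs : Summable fun i => κ k i * x i :=
      Summable.of_norm (by simpa only [habs] using hsum k)
    refine (hs.comp_injective (Subtype.val_injective (p := fun i => i ≠ k))).congr fun i => ?_
    simp only [Function.comp, rieszTerm_eq, hκ]
  · rw [weightedNorm, one_div, Real.rpow_inv_le_iff_of_pos (tsum_nonneg hr0) hB0 hq0]
    exact Real.tsum_le_of_sum_le hr0 hT

/-! ### Necessity of the class condition -/

theorem rpow_sum_rpow_le {ι : Type*} {S : Finset ι} {y : ι → ℝ} (hy : ∀ k, 0 ≤ y k) {p q : ℝ}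
    (hp : 0 < p) (hpq : p ≤ q) :
    (∑ k ∈ S, y k ^ q) ^ (1 / q) ≤ (∑ k ∈ S, y k ^ p) ^ (1 / p) := by
  set s := ∑ k ∈ S, y k ^ p with hs
  have hq : 0 < q := by linarith
  have hs0 : 0 ≤ s := sum_nonneg fun k _ => Real.rpow_nonneg (hy k) _
  rw [one_div, Real.rpow_inv_le_iff_of_pos (sum_nonneg fun k _ => Real.rpow_nonneg (hy k) _)
    (by positivity) hq]
  have hle : ∀ k ∈ S, y k ≤ s ^ (1 / p) := fun k hk => by
    rw [one_div, Real.le_rpow_inv_iff_of_pos (hy k) hs0 hp]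
    exact single_le_sum (f := fun k => y k ^ p) (fun k _ => Real.rpow_nonneg (hy k) _) hk
  have hsplit : ∀ a : ℝ, 0 ≤ a → a ^ q = a ^ p * a ^ (q - p) := fun a ha => by
    rw [← Real.rpow_add' ha (by linarith)]; congr 1; ring
  calc ∑ k ∈ S, y k ^ q ≤ ∑ k ∈ S, y k ^ p * (s ^ (1 / p)) ^ (q - p) := by
        refine sum_le_sum fun k hk => ?_
        rw [hsplit _ (hy k)]
        have := hle k hk
        have := hy k
        have : 0 ≤ q - p := by linarith
        gcongr
    _ = (s ^ (1 / p)) ^ p * (s ^ (1 / p)) ^ (q - p) := by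
        rw [← sum_mul, one_div, Real.rpow_inv_rpow hs0 hp.ne']
    _ = _ := (hsplit _ (by positivity)).symm

theorem RieszBounded.classA {α p q : ℝ} (hα1 : α < 1) (hp : 1 < p) (hpq : p ≤ q)
    (hβ : 1 / q + 1 / (p / (p - 1)) = 1 - α) {ω : ℤ → ℝ} (hω : ∀ k, 0 < ω k)
    (h : RieszBounded α p q (fun k => ω k ^ p) (fun k => ω k ^ q)) : ClassA p q ω := by
  obtain ⟨C, hC, h⟩ := h
  rw [classA_iff hβ hω]
  refine ⟨1 + C, fun m N => ?_⟩
  have hp0 : 0 < p := by linarith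
  have hq0 : 0 < q := by linarith
  have hp1 : p - 1 ≠ 0 := by linarith
  set P := p / (p - 1) with hP
  set S := symInterval m N with hS
  set σ : ℤ → ℝ := fun k => ω k ^ (-P) with hσd
  have hσ : ∀ k, 0 < σ k := fun k => Real.rpow_pos_of_pos (hω k) _
  set x : ℤ → ℝ := fun k => if k ∈ S then σ k else 0 with hx
  have hx0 : ∀ k, 0 ≤ x k := fun k => by simp only [hx]; split_ifs; exacts [(hσ k).le, le_rfl]
  have hxS : ∀ k ∈ S, x k = σ k := fun k hk => if_pos hk
  have hxn : ∀ k ∉ S, x k = 0 := fun k hk => if_neg hk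
  have hterm : ∀ k ∈ S, |x k| ^ p * ω k ^ p = σ k := fun k hk => by
    rw [abs_of_nonneg (hx0 k), hxS k hk]
    simp only [hσd]
    rw [← Real.rpow_mul (hω k).le, ← Real.rpow_add (hω k)]
    congr 1
    rw [hP]; field_simp; ring
  have hterm0 : ∀ k ∉ S, |x k| ^ p * ω k ^ p = 0 := fun k hk => by
    rw [hxn k hk, abs_zero, Real.zero_rpow hp0.ne', zero_mul]
  set s := mass σ m N with hs
  have hs0 : 0 < s := mass_pos hσ m N
  have hnorm : weightedNorm p (fun k => ω k ^ p) x = s ^ (1 / p) := by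
    rw [weightedNorm, tsum_eq_sum hterm0, sum_congr rfl hterm]; rfl
  obtain ⟨-, hmem, hbd⟩ := h x (summable_of_ne_finset_zero hterm0)
  rw [hnorm] at hbd
  have hcard : (0 : ℝ) < (S.card : ℝ) := by exact_mod_cast (symInterval_nonempty m N).card_pos
  set D := (S.card : ℝ) ^ (1 - α) with hD
  have hD0 : 0 < D := by positivity
  have hriesz : ∀ k, riesz α x k = ∑ i ∈ S, kernel (1 - α) k i * x i := fun k => by
    rw [riesz_eq_tsum, tsum_eq_sum fun i hi => by rw [hxn i hi, mul_zero]]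
  have hriesz0 : ∀ k, 0 ≤ riesz α x k := fun k => by
    rw [hriesz]; exact sum_nonneg fun i _ => mul_nonneg (kernel_nonneg _ _ _) (hx0 i)
  -- Inside S distances are at most |S|, so the kernel is at least 1/D off the diagonal; the added x
  -- k supplies the diagonal term.
  have hpt : ∀ k ∈ S, s ≤ D * (x k + riesz α x k) := by
    intro k hk
    have e : x k + riesz α x k = ∑ i ∈ S, ((if i = k then 1 else 0) + kernel (1 - α) k i) * x i := by
      simp only [add_mul, sum_add_distrib, ite_mul, one_mul, zero_mul, sum_ite_eq', if_pos hk,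
        hriesz]
    rw [e, mul_sum]
    refine sum_le_sum fun i hi => ?_
    rw [← hxS i hi, ← mul_assoc]
    refine le_mul_of_one_le_left (hx0 i) ?_
    have hc1 : (1 : ℝ) ≤ S.card := by exact_mod_cast (symInterval_nonempty m N).card_pos
    by_cases hik : i = k
    · simp only [kernel, hik, if_true, add_zero, mul_one]
      exact Real.one_le_rpow hc1 (by linarith)
    · simp only [kernel, hik, if_false, zero_add]
      have hd : |(k : ℝ) - i| ≤ S.card := by
        have : |k - i| ≤ (S.card : ℤ) := by
          rw [hS, card_symInterval, abs_le]
          simp only [hS, symInterval, mem_Icc] at hk hi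
          push_cast
          omega
        exact_mod_cast this
      have hd0 : 0 < |(k : ℝ) - i| := abs_pos.2 (sub_ne_zero.2 (by exact_mod_cast Ne.symm hik))
      rw [← div_eq_mul_inv, one_le_div (by positivity)]
      exact Real.rpow_le_rpow hd0.le hd (by linarith)
  have hI : (∑ k ∈ S, (ω k * riesz α x k) ^ q) ^ (1 / q) ≤ C * s ^ (1 / p) := by
    refine le_trans ?_ hbd
    have e : ∀ k, (ω k * riesz α x k) ^ q = |riesz α x k| ^ q * ω k ^ q := fun k => by
      rw [abs_of_nonneg (hriesz0 k), Real.mul_rpow (hω k).le (hriesz0 k), mul_comm]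
    have h0 : ∀ k, 0 ≤ |riesz α x k| ^ q * ω k ^ q := fun k => by
      have := hω k
      positivity
    simp only [e, weightedNorm]
    have := Summable.sum_le_tsum S (fun k _ => h0 k) hmem
    have : 0 ≤ ∑ k ∈ S, |riesz α x k| ^ q * ω k ^ q := sum_nonneg fun k _ => h0 k
    gcongr
  -- The added diagonal is harmless because the ℓ^q norm is at most the ℓ^p norm; it accounts for
  -- the 1 in 1 + C.
  have hX : (∑ k ∈ S, (ω k * x k) ^ q) ^ (1 / q) ≤ s ^ (1 / p) := by
    refine (rpow_sum_rpow_le (fun k => mul_nonneg (hω k).le (hx0 k)) hp0 hpq).trans (le_of_eq ?_)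
    congr 1
    refine sum_congr rfl fun k hk => ?_
    rw [Real.mul_rpow (hω k).le (hx0 k), mul_comm, ← hterm k hk, abs_of_nonneg (hx0 k)]
  have hmink := Real.Lp_add_le_of_nonneg (s := S) (p := q) (by linarith)
    (fun k _ => mul_nonneg (hω k).le (hx0 k)) (fun k _ => mul_nonneg (hω k).le (hriesz0 k))
  have hlow : mass (fun k => ω k ^ q) m N ^ (1 / q) * (s / D) ≤
      (∑ k ∈ S, (ω k * x k + ω k * riesz α x k) ^ q) ^ (1 / q) := by
    have hsD : 0 ≤ s / D := by positivity
    have hm := mass_pos (v := fun k => ω k ^ q) (fun k => Real.rpow_pos_of_pos (hω k) _) m N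
    rw [show s / D = ((s / D) ^ q) ^ (1 / q) by rw [one_div, Real.rpow_rpow_inv hsD hq0.ne'],
      ← Real.mul_rpow hm.le (Real.rpow_nonneg hsD q), mass, sum_mul]
    refine Real.rpow_le_rpow (sum_nonneg fun k _ => ?_) (sum_le_sum fun k hk => ?_) (by positivity)
    · have := hω k
      positivity
    · have := hω k
      rw [← Real.mul_rpow this.le hsD, ← mul_add]
      have h2 : s / D ≤ x k + riesz α x k := by
        rw [div_le_iff₀ hD0, mul_comm]; exact hpt k hk
      gcongr
  have hfinal : mass (fun k => ω k ^ q) m N ^ (1 / q) * (s / D) ≤ (1 + C) * s ^ (1 / p) :=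
    hlow.trans (hmink.trans (by linarith))
  have hse : s = s ^ (1 / P) * s ^ (1 / p) := by
    rw [← Real.rpow_add hs0]
    conv_lhs => rw [← Real.rpow_one s]
    congr 1
    rw [hP]; field_simp; ring
  have hsp : 0 < s ^ (1 / p) := by positivity
  refine le_of_mul_le_mul_right ?_ hsp
  rw [mul_assoc, ← hse]
  rw [← mul_div_assoc, div_le_iff₀ hD0] at hfinal
  linarith

/-! ### Sufficiency of the class condition -/

theorem ClassA.rieszBounded {α p q : ℝ} (hα1 : α < 1) (hp : 1 < p) (hpq : p < q)
    (hβ : 1 / q + 1 / (p / (p - 1)) = 1 - α) {ω : ℤ → ℝ} (hω : ∀ k, 0 < ω k)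
    (h : ClassA p q ω) : RieszBounded α p q (fun k => ω k ^ p) (fun k => ω k ^ q) := by
  obtain ⟨K, hK⟩ := (classA_iff hβ hω).1 h
  have hp0 : 0 < p := by linarith
  have hq0 : 0 < q := by linarith
  have hp1 : 0 < p - 1 := by linarith
  set β := 1 - α with hβd
  have hβ0 : 0 < β := by linarith
  set P := p / (p - 1) with hP
  have hP0 : 0 < P := by positivity
  set σ : ℤ → ℝ := fun k => ω k ^ (-P) with hσd
  set w : ℤ → ℝ := fun k => ω k ^ q with hwd
  have hσ : ∀ k, 0 < σ k := fun k => Real.rpow_pos_of_pos (hω k) _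
  have hw : ∀ k, 0 < w k := fun k => Real.rpow_pos_of_pos (hω k) _
  have hS : ∀ m N, (0 : ℝ) < (symInterval m N).card := fun m N => by
    exact_mod_cast (symInterval_nonempty m N).card_pos
  have hK0 : 0 < K := by
    have h1 := hK 0 0
    have := mass_pos hw 0 0
    have := mass_pos hσ 0 0
    have := hS 0 0
    have h2 : 0 < K * ((symInterval 0 0).card : ℝ) ^ β := lt_of_lt_of_le (by positivity) h1
    exact pos_of_mul_pos_left h2 (by positivity)
  -- The power 1/β makes the two exponents 1/(qβ) and 1/(p'β) add up to 1, the form needed for A_∞.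
  have hpow : ∀ m N, mass w m N ^ (1 / q / β) * mass σ m N ^ (1 / P / β) ≤
      K ^ β⁻¹ * ((symInterval m N).card : ℝ) := by
    intro m N
    have h1 := mass_pos hw m N
    have h2 := mass_pos hσ m N
    have h3 := hS m N
    have := Real.rpow_le_rpow (by positivity) (hK m N) (inv_nonneg.2 hβ0.le)
    rwa [Real.mul_rpow (by positivity) (by positivity), Real.mul_rpow hK0.le (by positivity),
      ← Real.rpow_mul h1.le, ← Real.rpow_mul h2.le, ← Real.rpow_mul h3.le,
      mul_inv_cancel₀ hβ0.ne', Real.rpow_one, ← div_eq_mul_inv, ← div_eq_mul_inv] at this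
  have hθ : 1 - 1 / q / β = 1 / P / β := by
    rw [sub_eq_iff_eq_add, ← add_div, add_comm, hβ, div_self hβ0.ne']
  have hθ' : 1 - 1 / P / β = 1 / q / β := by rw [← hθ]; ring
  have hθ0 : 0 < 1 / q / β := by positivity
  have hθ0' : 0 < 1 / P / β := by positivity
  have hone : ∀ k, w k ^ (1 / q / β) * σ k ^ (1 / P / β) = 1 := fun k => by
    simp only [hwd, hσd]
    rw [← Real.rpow_mul (hω k).le, ← Real.rpow_mul (hω k).le, ← Real.rpow_add (hω k)]
    rw [show q * (1 / q / β) + -P * (1 / P / β) = 0 by field_simp; ring, Real.rpow_zero]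
  obtain ⟨d, hd0, hd1, hwA⟩ := exists_aInfty hw hσ hθ0 (by linarith)
    (by simpa only [hθ] using hone) (K := K ^ β⁻¹) (by positivity) (by simpa only [hθ] using hpow)
  obtain ⟨c, hc0, hc1, hσA⟩ := exists_aInfty hσ hw hθ0' (by linarith)
    (by simpa only [hθ', mul_comm] using hone) (K := K ^ β⁻¹) (by positivity)
    (fun m N => by rw [hθ', mul_comm]; exact hpow m N)
  have hqt : q.HolderConjugate (q / (q - 1)) :=
    Real.HolderConjugate.conjExponent (by linarith)
  set t := q / (q - 1) with htd
  -- Any r strictly between p and q serves: r < q is what makes r' > q' = t.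
  set r := (p + q) / 2 with hrd
  have hr1 : 1 < r := by rw [hrd]; linarith
  have hrs : r.HolderConjugate (r / (r - 1)) := Real.HolderConjugate.conjExponent hr1
  have hts : t < r / (r - 1) := by
    rw [htd, div_lt_div_iff₀ (by linarith) (by linarith)]
    have : r < q := by rw [hrd]; linarith
    nlinarith
  have eP : 1 / p - 1 = -(1 / P) := by rw [hP]; field_simp; ring
  have et : 1 / t - 1 = -(1 / q) := by
    have := hqt.inv_add_inv_eq_one
    rw [one_div, one_div]; linarith
  obtain ⟨C, hC⟩ := exists_form_le hσ hw hβ0 hp (hqt.symm.lt) (by rw [hrd]; linarith) hts hrs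
    hK0.le hc0 hc1 hd0 hd1 hσA hwA (fun m N => by
      have h1 := mass_pos hw m N
      have h2 := mass_pos hσ m N
      have h3 := hS m N
      rw [eP, et, Real.rpow_neg h2.le, Real.rpow_neg h1.le, ← mul_inv, ← div_eq_mul_inv,
        inv_eq_one_div, div_le_div_iff₀ (by positivity) (by positivity), one_mul, mul_comm]
      exact hK m N)
  -- The form constant C carries no sign, so `max C 1` provides a positive one.
  refine rieszBounded_of_box (C := max C 1) hp (by linarith) (by positivity)
    (fun k => Real.rpow_pos_of_pos (hω k) _) hw fun H x hx => ?_
  have := rpow_sum_le_of_form_le hσ hw hp hqt (C := max C 1) (H := H) (by positivity)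
    (fun f g h1 h2 h3 h4 h5 h6 => (hC H f g h1 h2 h3 h4 h5 h6).trans (le_max_left _ _)) hx
  have e : ∀ k, σ k ^ (1 - p) = ω k ^ p := fun k => by
    simp only [hσd]
    rw [← Real.rpow_mul (hω k).le]
    congr 1
    rw [hP]; field_simp; ring
  simpa only [e] using this

end DiscreteRiesz

theorem theorem1p4 (α p q : ℝ) (hα0 : 0 < α) (hα1 : α < 1) (hp1 : 1 < p) (hpα : p < 1 / α)
    (hq : 1 / q = 1 / p - α) (ω : ℤ → ℝ) (hω : ∀ k, 0 < ω k) :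
    (DiscreteRiesz.ClassA p q ω →
      DiscreteRiesz.RieszBounded α p q (fun k => ω k ^ p) (fun k => ω k ^ q)) ∧
    ((MonotoneOn ω (Function.support ω) ∨ AntitoneOn ω (Function.support ω)) →
      DiscreteRiesz.RieszBounded α p q (fun k => ω k ^ p) (fun k => ω k ^ q) →
      DiscreteRiesz.ClassA p q ω) := by
  have hp0 : 0 < p := by linarith
  have hαp : α < 1 / p := (lt_one_div hp0 hα0).1 hpα
  have hq0 : 0 < q := one_div_pos.1 (by linarith)
  have hpq : p < q := (one_div_lt_one_div hq0 hp0).1 (by linarith)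
  have hβ : 1 / q + 1 / (p / (p - 1)) = 1 - α := by
    have : p - 1 ≠ 0 := by linarith
    rw [hq]; field_simp; ring
  exact ⟨DiscreteRiesz.ClassA.rieszBounded hα1 hp1 hpq hβ hω,
    fun _ => DiscreteRiesz.RieszBounded.classA hα1 hp1 hpq.le hβ hω⟩
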